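/- Let $M$ be a smooth $4$-dimensional manifold (without boundary) and let $f\colon M\to\mathbb S^5$ be a smooth immersion into the unit sphere $\mathbb S^5\subset\mathbb R^6$, i.e. an immersed hypersurface. For a local smooth unit normal field $\nu$ of $f$ in $\mathbb S^5$, let $A(v,w)=-\langle d\nu(v),df(w)\rangle$ be the second fundamental form and $S$ the shape operator, $df(Sv)=-d\nu(v)$; the principal curvatures $\lambda_1,\dots,\lambda_4$ are the eigenvalues of $S$, counted with multiplicity, the mean curvature is $H=\frac14\operatorname{tr}S=\frac14\sum_i\lambda_i$, and the Gauss (Gauss–Kronecker) curvature is $\mathcal K=\det S=\lambda_1\lambda_2\lambda_3\lambda_4$. Assume that - the hypersurface is minimal, i.e. $H\equiv0$; - it is isoparametric, i.e. its principal curvatures are constant: there are fixed real numbers $c_1,\dots,c_4$ such that near every point of $M$ there is a smooth unit normal field with respect to which the principal curvatures, counted with multiplicity, are $c_1,\dots,c_4$; - $\mathcal K\equiv 0$. Then the hypersurface is totally geodesic, i.e. $A\equiv0$. -/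

import Mathlib

open scoped Manifold ContDiff

noncomputable section

namespace SphereHypersurface

/-- The ambient Euclidean space `ℝⁿ⁺²` of the unit sphere `Sⁿ⁺¹`. -/
abbrev Ambient (n : ℕ) : Type := EuclideanSpace ℝ (Fin (n + 1 + 1))

/-- The unit sphere `Sⁿ⁺¹ ⊆ ℝⁿ⁺²`. -/
abbrev UnitSphere (n : ℕ) : Type := Metric.sphere (0 : Ambient n) 1

variable {n : ℕ} {M : Type*} [TopologicalSpace M] [ChartedSpace (EuclideanSpace ℝ (Fin n)) M]

instance finite_tangentSpace (p : M) : Module.Finite ℝ (TangentSpace (𝓡 n) p) :=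
  inferInstanceAs (Module.Finite ℝ (EuclideanSpace ℝ (Fin n)))

/-- `f : Mⁿ → Sⁿ⁺¹` is a smooth immersed hypersurface: `f` is smooth and its differential is
injective at every point. -/
structure IsHypersurface (f : M → UnitSphere n) : Prop where
  contMDiff : ContMDiff (𝓡 n) (𝓡 (n + 1)) ∞ f
  injective_mfderiv : ∀ p : M, Function.Injective (mfderiv (𝓡 n) (𝓡 (n + 1)) f p)

/-- The differential at `p` of `f`, regarded as a map into the ambient Euclidean space. -/
def differential (f : M → UnitSphere n) (p : M) : TangentSpace (𝓡 n) p →L[ℝ] Ambient n :=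
  mvfderiv (𝓡 n) (fun q ↦ (f q : Ambient n)) p

/-- `ν` is a smooth unit normal field of `f` in the sphere over the open set `U ⊆ M`: it is
tangent to the sphere along `f` and orthogonal to the image of the differential of `f`. -/
structure IsUnitNormalOn (f : M → UnitSphere n) (ν : M → Ambient n) (U : Set M) : Prop where
  isOpen : IsOpen U
  contMDiffOn : ContMDiffOn (𝓡 n) 𝓘(ℝ, Ambient n) ∞ ν U
  norm_eq_one : ∀ p ∈ U, ‖ν p‖ = 1
  tangent_sphere : ∀ p ∈ U, inner ℝ (ν p) (f p : Ambient n) = 0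
  normal : ∀ p ∈ U, ∀ v : TangentSpace (𝓡 n) p, inner ℝ (ν p) (differential f p v) = 0

/-- The second fundamental form `A(v, w) = -⟨∇̄_v ν, df(w)⟩` at `p` with respect to a unit normal
field `ν` defined near `p`. The Levi-Civita derivative `∇̄_v ν` of the sphere is the part tangent
to the sphere of the Euclidean derivative of `ν`, so that the two have the same inner product
with `df(w)`. -/
def secondFundamentalForm (f : M → UnitSphere n) (ν : M → Ambient n) (p : M)
    (v w : TangentSpace (𝓡 n) p) : ℝ :=
  -inner ℝ (mvfderiv (𝓡 n) ν p v) (differential f p w)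

/-- The shape operator `S` at `p` with respect to a unit normal field `ν` defined near `p`,
given by `df(S v) = -dν(v)`; see `differential_shapeOperator`. -/
def shapeOperator (f : M → UnitSphere n) (ν : M → Ambient n) (p : M) :
    TangentSpace (𝓡 n) p →ₗ[ℝ] TangentSpace (𝓡 n) p :=
  -((differential f p : TangentSpace (𝓡 n) p →ₗ[ℝ] Ambient n).leftInverse ∘ₗ
    (mvfderiv (𝓡 n) ν p : TangentSpace (𝓡 n) p →ₗ[ℝ] Ambient n))

/-- The differential of a hypersurface into the ambient space is injective. -/
theorem IsHypersurface.injective_differential {f : M → UnitSphere n} (hf : IsHypersurface f)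
    (p : M) : Function.Injective (differential f p) := by
  have : Fact (Module.finrank ℝ (Ambient n) = n + 1 + 1) :=
    ⟨finrank_euclideanSpace_fin⟩
  have hc : MDifferentiableAt (𝓡 (n + 1)) 𝓘(ℝ, Ambient n)
      ((↑) : UnitSphere n → Ambient n) (f p) :=
    (contMDiff_coe_sphere (m := 1) (f p)).mdifferentiableAt one_ne_zero
  have hd := (hf.contMDiff p).mdifferentiableAt (by simp)
  have key : ∀ v, differential f p v =
      mvfderiv (𝓡 (n + 1)) ((↑) : UnitSphere n → Ambient n) (f p)
        (mfderiv (𝓡 n) (𝓡 (n + 1)) f p v) := fun v ↦ mfderiv_comp_apply p hc hd v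
  intro v w h
  rw [key, key] at h
  exact hf.injective_mfderiv p (injective_mvfderiv_subtypeVal_sphere (f p) h)

/-- Product rule for the inner product of two maps into the ambient space. -/
theorem inner_mvfderiv_of_const {a b : M → Ambient n} {p : M}
    (ha : MDifferentiableAt (𝓡 n) 𝓘(ℝ, Ambient n) a p)
    (hb : MDifferentiableAt (𝓡 n) 𝓘(ℝ, Ambient n) b p) {c : ℝ}
    (h : ∀ᶠ q in nhds p, inner ℝ (a q) (b q) = c) (v : TangentSpace (𝓡 n) p) :
    inner ℝ (a p) (mvfderiv (𝓡 n) b p v) + inner ℝ (mvfderiv (𝓡 n) a p v) (b p) = 0 := by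
  let A : EuclideanSpace ℝ (Fin n) →L[ℝ] Ambient n := mvfderiv (𝓡 n) a p
  let B : EuclideanSpace ℝ (Fin n) →L[ℝ] Ambient n := mvfderiv (𝓡 n) b p
  have h1 : HasFDerivWithinAt (fun x ↦ a ((extChartAt (𝓡 n) p).symm x)) A
      (Set.range (𝓡 n)) (extChartAt (𝓡 n) p p) := ha.hasMFDerivAt.2
  have h2 : HasFDerivWithinAt (fun x ↦ b ((extChartAt (𝓡 n) p).symm x)) B
      (Set.range (𝓡 n)) (extChartAt (𝓡 n) p p) := hb.hasMFDerivAt.2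
  rw [ModelWithCorners.range_eq_univ, hasFDerivWithinAt_univ] at h1 h2
  have h3 := (h1.inner ℝ h2).congr_of_eventuallyEq (f₁ := fun _ ↦ c) (by
    have := (continuousAt_extChartAt_symm (I := 𝓡 n) p).eventually (by simpa using h)
    filter_upwards [this] with q hq
    exact hq.symm)
  have h4 := DFunLike.congr_fun (h3.unique (hasFDerivAt_const c _)) v
  have h5 : inner ℝ (a ((extChartAt (𝓡 n) p).symm (extChartAt (𝓡 n) p p))) (B v) +
      inner ℝ (A v) (b ((extChartAt (𝓡 n) p).symm (extChartAt (𝓡 n) p p))) = 0 := h4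
  rwa [extChartAt_to_inv] at h5

/-- The defining (Weingarten) equation `df(S v) = -dν(v)` of the shape operator. -/
theorem differential_shapeOperator {f : M → UnitSphere n} (hf : IsHypersurface f)
    {ν : M → Ambient n} {U : Set M} (hν : IsUnitNormalOn f ν U) {p : M} (hp : p ∈ U)
    (v : TangentSpace (𝓡 n) p) :
    differential f p (shapeOperator f ν p v) = -mvfderiv (𝓡 n) ν p v := by
  have hn : ∀ᶠ q in nhds p, q ∈ U := hν.isOpen.mem_nhds hp
  have hdν : MDifferentiableAt (𝓡 n) 𝓘(ℝ, Ambient n) ν p :=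
    (hν.contMDiffOn.contMDiffAt hn).mdifferentiableAt (by simp)
  have hdf : MDifferentiableAt (𝓡 n) 𝓘(ℝ, Ambient n) (fun q ↦ (f q : Ambient n)) p :=
    have : Fact (Module.finrank ℝ (Ambient n) = n + 1 + 1) := ⟨finrank_euclideanSpace_fin⟩
    ((contMDiff_coe_sphere (m := 1) (f p)).mdifferentiableAt one_ne_zero).comp p
      ((hf.contMDiff p).mdifferentiableAt (by simp))
  have hff : ∀ w, inner ℝ (f p : Ambient n) (differential f p w) = 0 := fun w ↦ by
    have := inner_mvfderiv_of_const hdf hdf (c := 1) (.of_forall fun q ↦ by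
      simp) w
    rw [real_inner_comm (f p : Ambient n) (mvfderiv _ _ _ _)] at this
    change inner ℝ (f p : Ambient n) (mvfderiv (𝓡 n) (fun q ↦ (f q : Ambient n)) p w) = 0
    linarith
  have hνν : inner ℝ (ν p) (mvfderiv (𝓡 n) ν p v) = 0 := by
    have := inner_mvfderiv_of_const hdν hdν (c := 1) (hn.mono fun q hq ↦ by
      simp [hν.norm_eq_one q hq]) v
    rw [real_inner_comm (ν p) (mvfderiv _ _ _ _)] at this
    linarith
  have hfν : inner ℝ (f p : Ambient n) (mvfderiv (𝓡 n) ν p v) = 0 := by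
    have := inner_mvfderiv_of_const hdν hdf (c := 0)
      (hn.mono fun q hq ↦ hν.tangent_sphere q hq) v
    have h' : inner ℝ (ν p) (mvfderiv (𝓡 n) (fun q ↦ (f q : Ambient n)) p v) = 0 :=
      hν.normal p hp v
    rw [real_inner_comm]
    linarith
  have hon : Orthonormal ℝ ![(f p : Ambient n), ν p] := by
    rw [orthonormal_vecCons_iff]
    have := hν.tangent_sphere p hp
    rw [real_inner_comm] at this
    simp [hν.norm_eq_one p hp, this, Orthonormal]
  let V : Submodule ℝ (Ambient n) := Submodule.span ℝ (Set.range ![(f p : Ambient n), ν p])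
  have hV : Module.finrank ℝ V = 2 := by
    simpa using finrank_span_eq_card hon.linearIndependent
  have hV' := V.finrank_add_finrank_orthogonal
  rw [hV, finrank_euclideanSpace_fin] at hV'
  have hmem : ∀ x : Ambient n, inner ℝ (f p : Ambient n) x = 0 → inner ℝ (ν p) x = 0 → x ∈ Vᗮ :=
    fun x h1 h2 ↦ by
      rw [Submodule.mem_orthogonal]
      intro u hu
      induction hu using Submodule.span_induction with
      | mem u hu =>
        obtain ⟨i, rfl⟩ := hu
        fin_cases i
        · exact h1
        · exact h2
      | zero => simp
      | add a b _ _ ha hb => rw [inner_add_left, ha, hb, add_zero]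
      | smul c a _ ha => rw [inner_smul_left, ha, mul_zero]
  let L : EuclideanSpace ℝ (Fin n) →ₗ[ℝ] Ambient n := (differential f p).toLinearMap
  have hinj : LinearMap.ker L = ⊥ := LinearMap.ker_eq_bot.2 (hf.injective_differential p)
  have hrange : LinearMap.range L = Vᗮ := by
    apply Submodule.eq_of_le_of_finrank_eq
    · rintro _ ⟨w, rfl⟩
      exact hmem _ (hff w) (hν.normal p hp w)
    · rw [LinearMap.finrank_range_of_inj (LinearMap.ker_eq_bot.1 hinj),
        finrank_euclideanSpace_fin]
      omega
  have hin : mvfderiv (𝓡 n) ν p v ∈ LinearMap.range L := hrange ▸ hmem _ hfν hνν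
  obtain ⟨w, hw⟩ := hin
  let w' : TangentSpace (𝓡 n) p := w
  have hS : shapeOperator f ν p v = -w' := by
    change -(L.leftInverse (mvfderiv (𝓡 n) ν p v)) = -w
    rw [← hw, LinearMap.leftInverse_apply_of_inj hinj w]
  rw [hS, map_neg]
  exact congrArg _ hw

/-- The principal curvatures at `p`, listed with multiplicity: the eigenvalues of the shape
operator. -/
def principalCurvatures (f : M → UnitSphere n) (ν : M → Ambient n) (p : M) : Multiset ℝ :=
  (shapeOperator f ν p).charpoly.roots

/-- The mean curvature `H = (1/n) tr A`. -/
def meanCurvature (f : M → UnitSphere n) (ν : M → Ambient n) (p : M) : ℝ :=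
  (n : ℝ)⁻¹ * LinearMap.trace ℝ (TangentSpace (𝓡 n) p) (shapeOperator f ν p)

/-- The Gauss (Gauss-Kronecker) curvature `𝒦`: the determinant of the shape operator, that is,
the product of the principal curvatures. -/
def gaussCurvature (f : M → UnitSphere n) (ν : M → Ambient n) (p : M) : ℝ :=
  LinearMap.det (shapeOperator f ν p)

/-- The mean curvature vanishes identically. -/
def IsMinimal (f : M → UnitSphere n) : Prop :=
  ∀ (U : Set M) (ν : M → Ambient n), IsUnitNormalOn f ν U → ∀ p ∈ U, meanCurvature f ν p = 0

/-- The Gauss curvature vanishes identically. -/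
def HasZeroGaussCurvature (f : M → UnitSphere n) : Prop :=
  ∀ (U : Set M) (ν : M → Ambient n), IsUnitNormalOn f ν U → ∀ p ∈ U, gaussCurvature f ν p = 0

/-- The principal curvatures are constant: near every point there is a unit normal field
with respect to which the principal curvatures, with multiplicity, are the same fixed numbers.
No global unit normal field is required. -/
def IsIsoparametric (f : M → UnitSphere n) : Prop :=
  ∃ c : Multiset ℝ, ∀ p : M, ∃ (U : Set M) (ν : M → Ambient n),
    p ∈ U ∧ IsUnitNormalOn f ν U ∧ ∀ q ∈ U, principalCurvatures f ν q = c

/-- The second fundamental form vanishes identically. -/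
def IsTotallyGeodesic (f : M → UnitSphere n) : Prop :=
  ∀ (U : Set M) (ν : M → Ambient n), IsUnitNormalOn f ν U →
    ∀ p ∈ U, ∀ v w : TangentSpace (𝓡 n) p, secondFundamentalForm f ν p v w = 0

end SphereHypersurface

end

/-
Regard the unit normal `N` as a second map into the sphere, the focal map. Let `T` be the shape
operator, `R` its pseudo-inverse and `P = T R` the projection onto the tangent spaces of the focal
map. Since `P dN = dN`, the symmetry of second derivatives shows that `P`, and then also the
derivative of `P` along the focal map, is constant along the leaves of `ker dN`. So the shape
operator `G w` of the focal map in the normal direction `w` is linear in `w` and does not change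
along a leaf, while `G F = R` and `G N = -P`.

The traces of `R` and `R²` are constant. Differentiating them twice along a leaf, in the direction
of a tangent vector `ξ ∈ ker T`, yields `tr (G ξ) = 0`, `tr R = 0`, `tr (R (G ξ)) = 0` and
`tr ((G ξ)²) = |ξ|² tr (R²)`. If `T ≠ 0`, then `G` is therefore injective on `ker T`, and its values
are symmetric operators supported on the range of `T`. As `T` acts on `ℝ⁶` and `dim ker T ≥ 3`, this
forces `T` to have rank three. Its nonzero eigenvalues then satisfy `a + b + c = 0` by minimality
and `a⁻¹ + b⁻¹ + c⁻¹ = tr R = 0`, hence `a² + b² + c² = 0`.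
-/

noncomputable section

namespace SphereHypersurface

open Module Polynomial
open scoped Topology

section Calculus

variable {E V W : Type*} [NormedAddCommGroup E] [NormedSpace ℝ E] [NormedAddCommGroup V]
  [NormedSpace ℝ V] [NormedAddCommGroup W]

theorem fderiv_apply_fderiv_eq_zero_of_fderiv_eq_comp [NormedSpace ℝ W] {g : E → V} {N : E → W}
    {B : E → W →L[ℝ] V} {x X : E} (hg : ContDiffAt ℝ 2 g x) (hN : ContDiffAt ℝ 2 N x)
    (hB : DifferentiableAt ℝ B x) (h : ∀ᶠ y in 𝓝 x, fderiv ℝ g y = B y ∘L fderiv ℝ N y)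
    (hX : fderiv ℝ N x X = 0) (v : E) : fderiv ℝ B x X (fderiv ℝ N x v) = 0 := by
  have hN' : DifferentiableAt ℝ (fderiv ℝ N) x :=
    (hN.fderiv_right (m := 1) le_rfl).differentiableAt one_ne_zero
  have second (u w : E) : fderiv ℝ (fderiv ℝ g) x u w =
      B x (fderiv ℝ (fderiv ℝ N) x u w) + fderiv ℝ B x u (fderiv ℝ N x w) := by
    rw [Filter.EventuallyEq.fderiv_eq h, fderiv_clm_comp hB hN']
    rfl
  have hg_symm := (hg.isSymmSndFDerivAt (by simp)).eq X v
  rw [second, second, (hN.isSymmSndFDerivAt (by simp)).eq X v, hX, map_zero] at hg_symm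
  simpa using hg_symm

theorem clm_apply_fderiv_eq_zero [NormedSpace ℝ W] (L : V →L[ℝ] W) {f : E → V} {x : E} {c : W}
    (hf : DifferentiableAt ℝ f x) (h : ∀ᶠ y in 𝓝 x, L (f y) = c) (v : E) :
    L (fderiv ℝ f x v) = 0 := by
  have := (L.hasFDerivAt.comp x hf.hasFDerivAt).unique
    ((hasFDerivAt_const c x).congr_of_eventuallyEq h)
  simpa using congr($this v)

theorem fderiv_mul_apply {𝔸 : Type*} [NormedRing 𝔸] [NormedAlgebra ℝ 𝔸] {a b : E → 𝔸} {x : E}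
    (ha : DifferentiableAt ℝ a x) (hb : DifferentiableAt ℝ b x) (v : E) :
    fderiv ℝ (fun y ↦ a y * b y) x v = a x * fderiv ℝ b x v + fderiv ℝ a x v * b x := by
  rw [fderiv_fun_mul' ha hb]
  rfl

theorem inner_fderiv_add_inner_fderiv_eq_zero [InnerProductSpace ℝ W] {f g : E → W} {x : E}
    {c : ℝ} (hf : DifferentiableAt ℝ f x) (hg : DifferentiableAt ℝ g x)
    (h : ∀ᶠ y in 𝓝 x, inner ℝ (f y) (g y) = c) (v : E) :
    inner ℝ (f x) (fderiv ℝ g x v) + inner ℝ (fderiv ℝ f x v) (g x) = 0 := by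
  rw [← fderiv_inner_apply ℝ hf hg, Filter.EventuallyEq.fderiv_eq (f := fun _ ↦ c) h]
  simp

theorem isSymmetric_fderiv [InnerProductSpace ℝ W] {A : E → W →L[ℝ] W} {x : E}
    (hA : DifferentiableAt ℝ A x) (h : ∀ᶠ y in 𝓝 x, (A y : W →ₗ[ℝ] W).IsSymmetric) (v : E) :
    (fderiv ℝ A x v : W →ₗ[ℝ] W).IsSymmetric := by
  intro a b
  have hdiff : ∀ c, DifferentiableAt ℝ (fun y ↦ A y c) x := fun c ↦
    hA.clm_apply (differentiableAt_const c)
  have hfderiv : ∀ c, fderiv ℝ (fun y ↦ A y c) x v = fderiv ℝ A x v c := fun c ↦ by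
    rw [fderiv_clm_apply hA (differentiableAt_const c)]
    simp
  have key := Filter.EventuallyEq.fderiv_eq (𝕜 := ℝ) (h.mono fun y hy ↦ hy a b)
  have := DFunLike.congr_fun key v
  simpa [fderiv_inner_apply ℝ (hdiff a) (differentiableAt_const b),
    fderiv_inner_apply ℝ (differentiableAt_const a) (hdiff b), hfderiv] using this

theorem contDiffOn_aeval {𝔸 : Type*} [NormedRing 𝔸] [NormedAlgebra ℝ 𝔸] {r : WithTop ℕ∞}
    {U : Set E} {T : E → 𝔸} (hT : ContDiffOn ℝ r T U) (p : ℝ[X]) :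
    ContDiffOn ℝ r (fun x ↦ aeval (T x) p) U := by
  simp only [aeval_eq_sum_range]
  exact ContDiffOn.sum fun i _ ↦ (hT.pow i).const_smul _

end Calculus

section SymmetricOperator

variable {W : Type*} [NormedAddCommGroup W] [InnerProductSpace ℝ W]

theorem toLinearMap_aeval (T : W →L[ℝ] W) (p : ℝ[X]) :
    (aeval T p : W →ₗ[ℝ] W) = aeval (T : W →ₗ[ℝ] W) p :=
  hom_eval₂ p (algebraMap ℝ (W →L[ℝ] W)) ContinuousLinearMap.toLinearMapRingHom T

theorem isSymmetric_aeval {T : W →L[ℝ] W} (hT : (T : W →ₗ[ℝ] W).IsSymmetric) (p : ℝ[X]) :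
    (aeval T p : W →ₗ[ℝ] W).IsSymmetric := by
  rw [toLinearMap_aeval]
  induction p using Polynomial.induction_on' with
  | add p q hp hq => simpa using hp.add hq
  | monomial k a =>
    rw [aeval_monomial, ← Algebra.smul_def]
    exact (hT.pow k).smul (by simp)

variable [FiniteDimensional ℝ W]

variable (W) in
/-- The trace of endomorphisms, as a continuous linear functional on continuous endomorphisms. -/
def traceCLM : (W →L[ℝ] W) →L[ℝ] ℝ :=
  LinearMap.toContinuousLinearMap (LinearMap.trace ℝ W ∘ₗ ContinuousLinearMap.coeLM ℝ)

theorem traceCLM_apply (A : W →L[ℝ] W) : traceCLM W A = LinearMap.trace ℝ W A := rfl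

theorem traceCLM_mul_comm (A B : W →L[ℝ] W) : traceCLM W (A * B) = traceCLM W (B * A) :=
  LinearMap.trace_mul_comm ℝ (A : W →ₗ[ℝ] W) B

theorem eq_zero_of_traceCLM_mul_self {A : W →L[ℝ] W} (hA : (A : W →ₗ[ℝ] W).IsSymmetric)
    (h : traceCLM W (A * A) = 0) : A = 0 := by
  let b := stdOrthonormalBasis ℝ W
  rw [traceCLM_apply, LinearMap.trace_eq_sum_inner _ b] at h
  have hterm : ∀ i, inner ℝ (b i) (A (A (b i))) = ‖A (b i)‖ ^ 2 := fun i ↦ by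
    rw [← real_inner_self_eq_norm_sq]
    exact (hA (b i) (A (b i))).symm
  change ∑ i, inner ℝ (b i) (A (A (b i))) = 0 at h
  simp only [hterm] at h
  rw [Finset.sum_eq_zero_iff_of_nonneg fun i _ ↦ sq_nonneg _] at h
  refine ContinuousLinearMap.coe_injective (b.toBasis.ext fun i ↦ ?_)
  simpa using h i (Finset.mem_univ i)

theorem exists_aeval_apply_orthonormalBasis {T : W →L[ℝ] W}
    (hT : (T : W →ₗ[ℝ] W).IsSymmetric) :
    ∃ (b : OrthonormalBasis (Fin (finrank ℝ W)) ℝ W) (μ : Fin (finrank ℝ W) → ℝ),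
      (T : W →ₗ[ℝ] W).charpoly.roots = Finset.univ.val.map μ ∧
        ∀ p i, aeval T p (b i) = p.eval (μ i) • b i := by
  refine ⟨hT.eigenvectorBasis rfl, hT.eigenvalues rfl, hT.roots_charpoly_eq_eigenvalues rfl,
    fun p i ↦ ?_⟩
  have := End.aeval_apply_of_hasEigenvector (p := p) (hT.hasEigenvector_eigenvectorBasis rfl i)
  rwa [← toLinearMap_aeval] at this

theorem aeval_eq_aeval_of_eval_eq {T : W →L[ℝ] W} (hT : (T : W →ₗ[ℝ] W).IsSymmetric) {p q : ℝ[X]}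
    (h : ∀ μ ∈ (T : W →ₗ[ℝ] W).charpoly.roots, p.eval μ = q.eval μ) : aeval T p = aeval T q := by
  obtain ⟨b, μ, hμ, hb⟩ := exists_aeval_apply_orthonormalBasis hT
  refine ContinuousLinearMap.coe_injective (b.toBasis.ext fun i ↦ ?_)
  simp [hb, h (μ i) (by simp [hμ])]

theorem traceCLM_aeval {T : W →L[ℝ] W} (hT : (T : W →ₗ[ℝ] W).IsSymmetric) (p : ℝ[X]) :
    traceCLM W (aeval T p) = ((T : W →ₗ[ℝ] W).charpoly.roots.map p.eval).sum := by
  obtain ⟨b, μ, hμ, hb⟩ := exists_aeval_apply_orthonormalBasis hT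
  rw [traceCLM_apply, LinearMap.trace_eq_sum_inner _ b, hμ]
  simp [hb, inner_smul_right, List.sum_ofFn]

theorem finrank_ker_eq_count_roots {T : W →ₗ[ℝ] W} (hT : T.IsSymmetric) :
    finrank ℝ T.ker = T.charpoly.roots.count 0 := by
  rw [count_roots, ← LinearMap.finrank_maxGenEigenspace_eq,
    hT.isFinitelySemisimple.maxGenEigenspace_eq_eigenspace, End.eigenspace_zero]

/-- The symmetric operators that vanish on the subspace `K`. -/
def symmetricVanishingOn (K : Submodule ℝ W) : Submodule ℝ (W →L[ℝ] W) where
  carrier := {A | (A : W →ₗ[ℝ] W).IsSymmetric ∧ ∀ u ∈ K, A u = 0}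
  add_mem' ha hb := ⟨ha.1.add hb.1, fun u hu ↦ by simp [ha.2 u hu, hb.2 u hu]⟩
  zero_mem' := ⟨LinearMap.IsSymmetric.zero, fun _ _ ↦ rfl⟩
  smul_mem' c A hA := ⟨hA.1.smul (by simp), fun u hu ↦ by simp [hA.2 u hu]⟩

theorem finrank_symmetricVanishingOn_le (K : Submodule ℝ W) :
    finrank ℝ (symmetricVanishingOn K) ≤ (finrank ℝ Kᗮ + 1).choose 2 := by
  let b := stdOrthonormalBasis ℝ Kᗮ
  let entries : symmetricVanishingOn K →ₗ[ℝ] Sym2 (Fin (finrank ℝ Kᗮ)) → ℝ :=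
    { toFun := fun A z ↦ z.lift ⟨fun i j ↦ inner ℝ (b i : W) (A.1 (b j)), fun i j ↦ by
        exact (A.2.1 (b i) (b j)).symm.trans (real_inner_comm _ _)⟩
      map_add' := fun A B ↦ by ext z; induction z; simp [inner_add_right]
      map_smul' := fun c A ↦ by ext z; induction z; simp [inner_smul_right] }
  have hentries : Function.Injective entries := by
    rw [injective_iff_map_eq_zero]
    rintro ⟨A, hA, hAK⟩ h0
    have hAb : ∀ i j, inner ℝ (b i : W) (A (b j)) = 0 := fun i j ↦ congrFun h0 s(i, j)
    refine Subtype.ext (ContinuousLinearMap.coe_injective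
      (hA.inner_map_self_eq_zero.1 fun x ↦ ?_))
    obtain ⟨k, hk, y, hy, rfl⟩ := K.exists_add_mem_mem_orthogonal x
    have hAy : inner ℝ (A y) y = 0 := by
      rw [show y = ∑ i, b.repr ⟨y, hy⟩ i • (b i : W) by
        simpa using (congrArg Subtype.val (b.sum_repr ⟨y, hy⟩)).symm]
      simp [sum_inner, inner_sum, inner_smul_left, inner_smul_right, real_inner_comm, hAb]
    have hAyk : inner ℝ (A y) k = 0 := (hA y k).trans (by simp [hAK k hk])
    simp [inner_add_right, hAK k hk, hAy, hAyk]
  simpa [Sym2.card] using LinearMap.finrank_le_finrank_of_injective hentries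

end SymmetricOperator

section PseudoInverse

variable {W : Type*} [NormedAddCommGroup W] [InnerProductSpace ℝ W]

/-- The interpolation polynomial of `μ ↦ μ⁻¹` on `s`, with the convention `0⁻¹ = 0`. -/
def inverseInterpolant (s : Multiset ℝ) : ℝ[X] :=
  Lagrange.interpolate s.toFinset id (·⁻¹)

theorem eval_inverseInterpolant {s : Multiset ℝ} {μ : ℝ} (hμ : μ ∈ s) :
    (inverseInterpolant s).eval μ = μ⁻¹ :=
  Lagrange.eval_interpolate_at_node (v := id) (·⁻¹) (Set.injOn_id _) (Multiset.mem_toFinset.2 hμ)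

/-- The pseudo-inverse of a symmetric operator `T` whose eigenvalues all lie in `s`. It is written
as a polynomial in `T` that depends only on `s`, so that it varies smoothly with `T` as long as the
spectrum is fixed. -/
def pseudoInverse (s : Multiset ℝ) (T : W →L[ℝ] W) : W →L[ℝ] W :=
  aeval T (inverseInterpolant s)

theorem pseudoInverse_mul_comm (s : Multiset ℝ) (T : W →L[ℝ] W) :
    pseudoInverse s T * T = T * pseudoInverse s T := by
  simpa [pseudoInverse] using congrArg (aeval T) (mul_comm (inverseInterpolant s) X)

theorem isSymmetric_pseudoInverse (s : Multiset ℝ) {T : W →L[ℝ] W}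
    (hT : (T : W →ₗ[ℝ] W).IsSymmetric) : (pseudoInverse s T : W →ₗ[ℝ] W).IsSymmetric :=
  isSymmetric_aeval hT _

theorem isSymmetric_mul_pseudoInverse (s : Multiset ℝ) {T : W →L[ℝ] W}
    (hT : (T : W →ₗ[ℝ] W).IsSymmetric) :
    (T * pseudoInverse s T : W →L[ℝ] W).toLinearMap.IsSymmetric :=
  hT.mul_of_commute (isSymmetric_pseudoInverse s hT)
    (congrArg ContinuousLinearMap.toLinearMap (pseudoInverse_mul_comm s T).symm)

variable [FiniteDimensional ℝ W] {s : Multiset ℝ} {T : W →L[ℝ] W}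

theorem mul_pseudoInverse_mul (hT : (T : W →ₗ[ℝ] W).IsSymmetric)
    (hs : (T : W →ₗ[ℝ] W).charpoly.roots = s) : T * pseudoInverse s T * T = T := by
  subst hs
  have := aeval_eq_aeval_of_eval_eq hT (q := X)
    (p := X * inverseInterpolant (T : W →ₗ[ℝ] W).charpoly.roots * X)
    fun μ hμ ↦ by simp only [eval_mul, eval_X, eval_inverseInterpolant hμ, mul_inv_mul_cancel]
  rwa [map_mul, map_mul, aeval_X] at this

theorem pseudoInverse_mul_mul (hT : (T : W →ₗ[ℝ] W).IsSymmetric)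
    (hs : (T : W →ₗ[ℝ] W).charpoly.roots = s) :
    pseudoInverse s T * T * pseudoInverse s T = pseudoInverse s T := by
  subst hs
  set q := inverseInterpolant (T : W →ₗ[ℝ] W).charpoly.roots with hq
  have := aeval_eq_aeval_of_eval_eq hT (p := q * X * q) (q := q)
    fun μ hμ ↦ by simpa [hq, eval_inverseInterpolant hμ] using mul_inv_mul_cancel μ⁻¹
  rwa [map_mul, map_mul, aeval_X] at this

theorem traceCLM_pseudoInverse_pow (hT : (T : W →ₗ[ℝ] W).IsSymmetric)
    (hs : (T : W →ₗ[ℝ] W).charpoly.roots = s) (k : ℕ) :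
    traceCLM W (pseudoInverse s T ^ k) = (s.map fun μ ↦ μ⁻¹ ^ k).sum := by
  rw [pseudoInverse, ← map_pow, traceCLM_aeval hT, hs]
  refine congrArg Multiset.sum (Multiset.map_congr rfl fun μ hμ ↦ ?_)
  rw [eval_pow, eval_inverseInterpolant hμ]

end PseudoInverse

section LocalHypersurface

variable {E W : Type*} [NormedAddCommGroup E] [NormedSpace ℝ E]
  [NormedAddCommGroup W] [InnerProductSpace ℝ W]

/-- A hypersurface `F` of the unit sphere with unit normal field `N`, given over an open subset of
a vector space. -/
structure IsLocalHypersurface (U : Set E) (F N : E → W) : Prop where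
  isOpen : IsOpen U
  finrank_eq : finrank ℝ W = finrank ℝ E + 2
  contDiffOn_F : ContDiffOn ℝ ∞ F U
  contDiffOn_N : ContDiffOn ℝ ∞ N U
  norm_F : ∀ x ∈ U, ‖F x‖ = 1
  norm_N : ∀ x ∈ U, ‖N x‖ = 1
  inner_F_N : ∀ x ∈ U, inner ℝ (F x) (N x) = 0
  inner_N_fderiv_F : ∀ x ∈ U, ∀ v, inner ℝ (N x) (fderiv ℝ F x v) = 0
  injective_fderiv_F : ∀ x ∈ U, Function.Injective (fderiv ℝ F x)

/-- The frame `(v, s, t) ↦ D v + s a + t b` of the ambient space, for `D` the differential of a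
hypersurface at a point and `a`, `b` its position and its unit normal there. -/
def adaptedFrame (D : E →L[ℝ] W) (a b : W) : E × ℝ × ℝ →L[ℝ] W :=
  D ∘L .fst ℝ E (ℝ × ℝ) +
    ((ContinuousLinearMap.fst ℝ ℝ ℝ ∘L .snd ℝ E (ℝ × ℝ)).smulRight a +
      (ContinuousLinearMap.snd ℝ ℝ ℝ ∘L .snd ℝ E (ℝ × ℝ)).smulRight b)

theorem adaptedFrame_apply (D : E →L[ℝ] W) (a b : W) (v : E) (s t : ℝ) :
    adaptedFrame D a b (v, s, t) = D v + (s • a + t • b) := by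
  simp [adaptedFrame]

theorem isInvertible_adaptedFrame [FiniteDimensional ℝ E] [FiniteDimensional ℝ W]
    (hW : finrank ℝ W = finrank ℝ E + 2) {D : E →L[ℝ] W} {a b : W}
    (hD : Function.Injective D) (ha : ‖a‖ = 1) (hb : ‖b‖ = 1) (hab : inner ℝ a b = 0)
    (haD : ∀ v, inner ℝ a (D v) = 0) (hbD : ∀ v, inner ℝ b (D v) = 0) :
    (adaptedFrame D a b).IsInvertible := by
  have hinj : Function.Injective (adaptedFrame D a b : E × ℝ × ℝ →ₗ[ℝ] W) := by
    rw [injective_iff_map_eq_zero]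
    rintro ⟨v, s, t⟩ h
    change adaptedFrame D a b (v, s, t) = 0 at h
    rw [adaptedFrame_apply] at h
    obtain rfl : s = 0 := by
      simpa [inner_add_right, inner_smul_right, haD, hab, ha] using congrArg (inner ℝ a) h
    obtain rfl : t = 0 := by
      simpa [inner_add_right, inner_smul_right, hbD, hb] using congrArg (inner ℝ b) h
    simpa [hD.eq_iff' (map_zero D)] using h
  exact ⟨(LinearEquiv.ofInjectiveOfFinrankEq _ hinj (by simp [hW])).toContinuousLinearEquiv, rfl⟩

/-- The component in `E` of an ambient vector with respect to the adapted frame. -/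
def tangentPart (F N : E → W) (x : E) : W →L[ℝ] E :=
  ContinuousLinearMap.fst ℝ E (ℝ × ℝ) ∘L (adaptedFrame (fderiv ℝ F x) (F x) (N x)).inverse

/-- The shape operator, regarded as an operator of the ambient space vanishing on the span of the
position and the normal vector. -/
def ambientShape (F N : E → W) (x : E) : W →L[ℝ] W :=
  -(fderiv ℝ N x ∘L tangentPart F N x)

namespace IsLocalHypersurface

variable {U : Set E} {F N : E → W}

section Differentials

theorem eventually_mem (h : IsLocalHypersurface U F N) {x : E} (hx : x ∈ U) : ∀ᶠ y in 𝓝 x, y ∈ U :=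
  h.isOpen.mem_nhds hx

theorem contDiffAt_F (h : IsLocalHypersurface U F N) {x : E} (hx : x ∈ U) : ContDiffAt ℝ ∞ F x :=
  h.contDiffOn_F.contDiffAt (h.isOpen.mem_nhds hx)

theorem contDiffAt_N (h : IsLocalHypersurface U F N) {x : E} (hx : x ∈ U) : ContDiffAt ℝ ∞ N x :=
  h.contDiffOn_N.contDiffAt (h.isOpen.mem_nhds hx)

theorem differentiableAt_F (h : IsLocalHypersurface U F N) {x : E} (hx : x ∈ U) :
    DifferentiableAt ℝ F x :=
  (h.contDiffAt_F hx).differentiableAt (by simp)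

theorem differentiableAt_N (h : IsLocalHypersurface U F N) {x : E} (hx : x ∈ U) :
    DifferentiableAt ℝ N x :=
  (h.contDiffAt_N hx).differentiableAt (by simp)

theorem inner_F_fderiv_F (h : IsLocalHypersurface U F N) {x : E} (hx : x ∈ U) (v : E) :
    inner ℝ (F x) (fderiv ℝ F x v) = 0 := by
  have := inner_fderiv_add_inner_fderiv_eq_zero (c := 1) (h.differentiableAt_F hx)
    (h.differentiableAt_F hx) ((h.eventually_mem hx).mono fun y hy ↦ by simp [h.norm_F y hy]) v
  rw [real_inner_comm (F x)] at this
  linarith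

theorem inner_N_fderiv_N (h : IsLocalHypersurface U F N) {x : E} (hx : x ∈ U) (v : E) :
    inner ℝ (N x) (fderiv ℝ N x v) = 0 := by
  have := inner_fderiv_add_inner_fderiv_eq_zero (c := 1) (h.differentiableAt_N hx)
    (h.differentiableAt_N hx) ((h.eventually_mem hx).mono fun y hy ↦ by simp [h.norm_N y hy]) v
  rw [real_inner_comm (N x)] at this
  linarith

theorem inner_F_fderiv_N (h : IsLocalHypersurface U F N) {x : E} (hx : x ∈ U) (v : E) :
    inner ℝ (F x) (fderiv ℝ N x v) = 0 := by
  have := inner_fderiv_add_inner_fderiv_eq_zero (h.differentiableAt_F hx)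
    (h.differentiableAt_N hx) ((h.eventually_mem hx).mono h.inner_F_N) v
  rwa [real_inner_comm (N x), h.inner_N_fderiv_F x hx, add_zero] at this

theorem inner_fderiv_N_fderiv_F (h : IsLocalHypersurface U F N) {x : E} (hx : x ∈ U) (v w : E) :
    inner ℝ (fderiv ℝ N x v) (fderiv ℝ F x w) =
      -inner ℝ (N x) (fderiv ℝ (fderiv ℝ F) x v w) := by
  have hF' : DifferentiableAt ℝ (fderiv ℝ F) x :=
    ((h.contDiffAt_F hx).fderiv_right (m := ∞) (by simp)).differentiableAt (by simp)
  have := inner_fderiv_add_inner_fderiv_eq_zero (h.differentiableAt_N hx)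
    (hF'.clm_apply (differentiableAt_const w))
    ((h.eventually_mem hx).mono fun y hy ↦ h.inner_N_fderiv_F y hy w) v
  rw [fderiv_clm_apply hF' (differentiableAt_const w)] at this
  simpa using eq_neg_of_add_eq_zero_right this

theorem inner_fderiv_N_fderiv_F_comm (h : IsLocalHypersurface U F N) {x : E} (hx : x ∈ U)
    (v w : E) : inner ℝ (fderiv ℝ N x v) (fderiv ℝ F x w) =
      inner ℝ (fderiv ℝ N x w) (fderiv ℝ F x v) := by
  have hsymm : IsSymmSndFDerivAt ℝ F x :=
    (contDiffAt_infty.1 (h.contDiffAt_F hx) 2).isSymmSndFDerivAt (by simp)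
  rw [h.inner_fderiv_N_fderiv_F hx, h.inner_fderiv_N_fderiv_F hx, hsymm.eq]

end Differentials

variable [FiniteDimensional ℝ E] [FiniteDimensional ℝ W]

theorem isInvertible (h : IsLocalHypersurface U F N) {x : E} (hx : x ∈ U) :
    (adaptedFrame (fderiv ℝ F x) (F x) (N x)).IsInvertible :=
  isInvertible_adaptedFrame h.finrank_eq (h.injective_fderiv_F x hx) (h.norm_F x hx)
    (h.norm_N x hx) (h.inner_F_N x hx) (h.inner_F_fderiv_F hx) (h.inner_N_fderiv_F x hx)

theorem tangentPart_adaptedFrame (h : IsLocalHypersurface U F N) {x : E} (hx : x ∈ U) (v : E)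
    (s t : ℝ) : tangentPart F N x (fderiv ℝ F x v + (s • F x + t • N x)) = v := by
  rw [← adaptedFrame_apply, tangentPart, ContinuousLinearMap.comp_apply,
    (h.isInvertible hx).inverse_apply_self]
  rfl

theorem tangentPart_fderiv_F (h : IsLocalHypersurface U F N) {x : E} (hx : x ∈ U) (v : E) :
    tangentPart F N x (fderiv ℝ F x v) = v := by
  simpa using h.tangentPart_adaptedFrame hx v 0 0

theorem tangentPart_F (h : IsLocalHypersurface U F N) {x : E} (hx : x ∈ U) :
    tangentPart F N x (F x) = 0 := by
  simpa using h.tangentPart_adaptedFrame hx 0 1 0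

theorem tangentPart_N (h : IsLocalHypersurface U F N) {x : E} (hx : x ∈ U) :
    tangentPart F N x (N x) = 0 := by
  simpa using h.tangentPart_adaptedFrame hx 0 0 1

theorem exists_eq_fderiv_F_add (h : IsLocalHypersurface U F N) {x : E} (hx : x ∈ U) (w : W) :
    ∃ (v : E) (s t : ℝ), w = fderiv ℝ F x v + (s • F x + t • N x) := by
  obtain ⟨⟨v, s, t⟩, hv⟩ := (h.isInvertible hx).bijective.surjective w
  exact ⟨v, s, t, by rw [← hv, adaptedFrame_apply]⟩

theorem fderiv_F_tangentPart (h : IsLocalHypersurface U F N) {x : E} (hx : x ∈ U) {w : W}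
    (hFw : inner ℝ (F x) w = 0) (hNw : inner ℝ (N x) w = 0) :
    fderiv ℝ F x (tangentPart F N x w) = w := by
  obtain ⟨v, s, t, rfl⟩ := h.exists_eq_fderiv_F_add hx w
  have hNF : inner ℝ (N x) (F x) = 0 := by rw [real_inner_comm, h.inner_F_N x hx]
  obtain rfl : s = 0 := by
    simpa [inner_add_right, inner_smul_right, h.inner_F_fderiv_F hx, h.inner_F_N x hx,
      h.norm_F x hx] using hFw
  obtain rfl : t = 0 := by
    simpa [inner_add_right, inner_smul_right, h.inner_N_fderiv_F x hx, hNF, h.norm_N x hx]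
      using hNw
  rw [h.tangentPart_adaptedFrame hx, zero_smul, zero_smul, add_zero, add_zero]

theorem ambientShape_fderiv_F (h : IsLocalHypersurface U F N) {x : E} (hx : x ∈ U) (v : E) :
    ambientShape F N x (fderiv ℝ F x v) = -fderiv ℝ N x v := by
  simp [ambientShape, h.tangentPart_fderiv_F hx]

theorem ambientShape_F (h : IsLocalHypersurface U F N) {x : E} (hx : x ∈ U) :
    ambientShape F N x (F x) = 0 := by
  simp [ambientShape, h.tangentPart_F hx]

theorem ambientShape_N (h : IsLocalHypersurface U F N) {x : E} (hx : x ∈ U) :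
    ambientShape F N x (N x) = 0 := by
  simp [ambientShape, h.tangentPart_N hx]

theorem contDiffOn_tangentPart (h : IsLocalHypersurface U F N) :
    ContDiffOn ℝ ∞ (tangentPart F N) U := by
  intro x hx
  have hframe : ContDiffAt ℝ ∞ (fun y ↦ adaptedFrame (fderiv ℝ F y) (F y) (N y)) x :=
    (((h.contDiffAt_F hx).fderiv_right (by simp)).clm_comp contDiffAt_const).add
      ((contDiffAt_const.smulRight (h.contDiffAt_F hx)).add
        (contDiffAt_const.smulRight (h.contDiffAt_N hx)))
  have hinverse : ContDiffAt ℝ ∞ (fun y ↦ (adaptedFrame (fderiv ℝ F y) (F y) (N y)).inverse) x :=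
    .comp (g := ContinuousLinearMap.inverse) x (h.isInvertible hx).contDiffAt_map_inverse hframe
  exact (contDiffAt_const.clm_comp hinverse).contDiffWithinAt

theorem contDiffOn_ambientShape (h : IsLocalHypersurface U F N) :
    ContDiffOn ℝ ∞ (ambientShape F N) U := by
  have hN' : ContDiffOn ℝ ∞ (fderiv ℝ N) U := h.contDiffOn_N.fderiv_of_isOpen h.isOpen (by simp)
  exact (hN'.clm_comp h.contDiffOn_tangentPart).neg

theorem isSymmetric_ambientShape (h : IsLocalHypersurface U F N) {x : E} (hx : x ∈ U) :
    (ambientShape F N x : W →ₗ[ℝ] W).IsSymmetric := by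
  intro a b
  obtain ⟨v, s, t, rfl⟩ := h.exists_eq_fderiv_F_add hx a
  obtain ⟨v', s', t', rfl⟩ := h.exists_eq_fderiv_F_add hx b
  have hNF (u : E) : inner ℝ (fderiv ℝ N x u) (F x) = 0 := by
    rw [real_inner_comm, h.inner_F_fderiv_N hx]
  have hNN (u : E) : inner ℝ (fderiv ℝ N x u) (N x) = 0 := by
    rw [real_inner_comm, h.inner_N_fderiv_N hx]
  simp only [ContinuousLinearMap.coe_coe, map_add, map_smul, h.ambientShape_fderiv_F hx,
    h.ambientShape_F hx, h.ambientShape_N hx, inner_add_right, inner_add_left, inner_smul_left,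
    inner_smul_right, inner_neg_left, inner_neg_right, hNF, hNN, h.inner_F_fderiv_N hx,
    h.inner_N_fderiv_N hx, smul_zero, add_zero, neg_zero, mul_zero]
  rw [h.inner_fderiv_N_fderiv_F_comm hx, real_inner_comm]

theorem charpoly_ambientShape (h : IsLocalHypersurface U F N) {x : E} (hx : x ∈ U) {S : E →ₗ[ℝ] E}
    (hS : ∀ v, fderiv ℝ F x (S v) = -fderiv ℝ N x v) :
    (ambientShape F N x : W →ₗ[ℝ] W).charpoly = S.charpoly * X ^ 2 := by
  obtain ⟨G, hG⟩ := h.isInvertible hx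
  have hG_apply (v : E) (s t : ℝ) : G (v, s, t) = fderiv ℝ F x v + (s • F x + t • N x) :=
    (DFunLike.congr_fun hG _).trans (adaptedFrame_apply ..)
  have hconj : (ambientShape F N x : W →ₗ[ℝ] W) =
      G.toLinearEquiv.conj (S.prodMap (0 : ℝ × ℝ →ₗ[ℝ] ℝ × ℝ)) := by
    ext w
    obtain ⟨⟨v, s, t⟩, rfl⟩ := G.toLinearEquiv.surjective w
    rw [LinearEquiv.conj_apply_apply, LinearEquiv.symm_apply_apply]
    change ambientShape F N x (G (v, s, t)) = G (S v, 0, 0)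
    simp [hG_apply, h.ambientShape_fderiv_F hx, h.ambientShape_F hx, h.ambientShape_N hx, hS]
  rw [hconj, LinearEquiv.charpoly_conj, LinearMap.charpoly_prodMap, LinearMap.charpoly_zero]
  simp

theorem exists_N_eq_smul (h : IsLocalHypersurface U F N) {U' : Set E} {N' : E → W}
    (h' : IsLocalHypersurface U' F N') {x : E} (hx : x ∈ U) (hx' : x ∈ U') :
    ∃ c : ℝ, N x = c • N' x := by
  obtain ⟨v, s, t, hN⟩ := h'.exists_eq_fderiv_F_add hx' (N x)
  have hs : s = 0 := by
    have := h.inner_F_N x hx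
    rw [hN] at this
    simpa [inner_add_right, inner_smul_right, h.inner_F_fderiv_F hx, h'.inner_F_N x hx',
      h.norm_F x hx] using this
  have hv : fderiv ℝ F x v = 0 := by
    have := h.inner_N_fderiv_F x hx v
    rw [hN] at this
    simpa [inner_add_left, inner_smul_left, h.inner_F_fderiv_F hx, h'.inner_N_fderiv_F x hx']
      using this
  exact ⟨t, by simpa [hs, hv] using hN⟩

theorem inner_fderiv_N_fderiv_F_eq_zero (h : IsLocalHypersurface U F N) {U' : Set E} {N' : E → W}
    (h' : IsLocalHypersurface U' F N') {x : E} (hx : x ∈ U) (hx' : x ∈ U')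
    (h0 : ambientShape F N' x = 0) (v w : E) :
    inner ℝ (fderiv ℝ N x v) (fderiv ℝ F x w) = 0 := by
  obtain ⟨c, hc⟩ := h.exists_N_eq_smul h' hx hx'
  have hN' : fderiv ℝ N' x v = 0 := by simpa [h0] using h'.ambientShape_fderiv_F hx' v
  calc inner ℝ (fderiv ℝ N x v) (fderiv ℝ F x w)
      = c * inner ℝ (fderiv ℝ N' x v) (fderiv ℝ F x w) := by
        rw [h.inner_fderiv_N_fderiv_F hx, h'.inner_fderiv_N_fderiv_F hx', hc, real_inner_smul_left,
          mul_neg]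
    _ = 0 := by rw [hN', inner_zero_left, mul_zero]

end IsLocalHypersurface

end LocalHypersurface

theorem inv_add_inv_add_inv_ne_zero {𝕜 : Type*} [Field 𝕜] [LinearOrder 𝕜] [IsStrictOrderedRing 𝕜]
    {a b c : 𝕜} (ha : a ≠ 0) (hb : b ≠ 0) (hc : c ≠ 0) (hsum : a + b + c = 0) :
    a⁻¹ + b⁻¹ + c⁻¹ ≠ 0 := by
  intro hinv
  field_simp at hinv
  have : a ^ 2 + b ^ 2 + c ^ 2 = 0 := by linear_combination (a + b + c) * hsum - 2 * hinv
  exact (by positivity : a ^ 2 + b ^ 2 + c ^ 2 ≠ 0) this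

section FocalMap

variable {E W : Type*} [NormedAddCommGroup E] [NormedSpace ℝ E]
  [NormedAddCommGroup W] [InnerProductSpace ℝ W]

/-- The pseudo-inverse of the ambient shape operator of a hypersurface with spectrum `s`. -/
def shapePinv (s : Multiset ℝ) (F N : E → W) (x : E) : W →L[ℝ] W :=
  pseudoInverse s (ambientShape F N x)

/-- The orthogonal projection onto the range of the shape operator, which is the tangent space of
the focal map `N`. -/
def focalProjection (s : Multiset ℝ) (F N : E → W) (x : E) : W →L[ℝ] W :=
  ambientShape F N x * shapePinv s F N x

/-- A right inverse of `dN` on the tangent space of the focal map `N`. -/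
def focalLift (s : Multiset ℝ) (F N : E → W) (x : E) : W →L[ℝ] E :=
  -(tangentPart F N x ∘L shapePinv s F N x)

/-- The derivative `u ↦ (w ↦ (∂ᵤ P) w)` of the projection `P` onto the tangent spaces of the focal
map `N`, taken in the direction of a tangent vector `u` of the focal map. -/
def focalTensor (s : Multiset ℝ) (F N : E → W) (x : E) : W →L[ℝ] W →L[ℝ] W :=
  fderiv ℝ (focalProjection s F N) x ∘L focalLift s F N x

/-- The shape operator `u ↦ (∂ᵤ P) w` of the focal map `N` in the normal direction `w`. -/
def focalShape (s : Multiset ℝ) (F N : E → W) (x : E) : W →L[ℝ] W →L[ℝ] W :=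
  (focalTensor s F N x).flip

theorem focalProjection_apply_eq_zero (s : Multiset ℝ) {F N : E → W} {x : E} {w : W}
    (hw : ambientShape F N x w = 0) : focalProjection s F N x w = 0 := by
  rw [focalProjection, shapePinv, ← pseudoInverse_mul_comm, mul_apply_eq_comp, hw, map_zero]

theorem fderiv_N_focalLift (s : Multiset ℝ) (F N : E → W) (x : E) (u : W) :
    fderiv ℝ N x (focalLift s F N x u) = focalProjection s F N x u := by
  simp [focalLift, focalProjection, ambientShape]

/-- The tangent vectors of the hypersurface, regarded as ambient vectors, on which the shape
operator vanishes. -/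
def shapeKernel (F N : E → W) (x : E) : Submodule ℝ W :=
  (ambientShape F N x).ker ⊓ ((innerSL ℝ (F x)).ker ⊓ (innerSL ℝ (N x)).ker)

/-- A vector field with values in the kernels of the shape operators that extends a given vector
`ξ` of one of them. -/
def kernelField (s : Multiset ℝ) (F N : E → W) (ξ : W) (y : E) : W :=
  ξ - focalProjection s F N y ξ - inner ℝ (F y) ξ • F y - inner ℝ (N y) ξ • N y

theorem mem_shapeKernel {F N : E → W} {x : E} {ξ : W} : ξ ∈ shapeKernel F N x ↔
    ambientShape F N x ξ = 0 ∧ inner ℝ (F x) ξ = 0 ∧ inner ℝ (N x) ξ = 0 := by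
  simp [shapeKernel]

theorem exists_ne_zero_mem_shapeKernel [FiniteDimensional ℝ W] {F N : E → W} {x : E}
    (h : 3 ≤ finrank ℝ (ambientShape F N x).ker) : ∃ ξ ∈ shapeKernel F N x, ξ ≠ 0 := by
  let p : (ambientShape F N x).ker →ₗ[ℝ] ℝ × ℝ :=
    ((innerₛₗ ℝ (F x)).prod (innerₛₗ ℝ (N x))).domRestrict _
  obtain ⟨ξ, hξ, hξ0⟩ := p.ker.ne_bot_iff.1 (LinearMap.ker_ne_bot_of_finrank_lt (by simp; omega))
  exact ⟨ξ, mem_shapeKernel.2 ⟨ξ.2, by simpa [p] using hξ⟩, by simpa using hξ0⟩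

theorem kernelField_eq (s : Multiset ℝ) {F N : E → W} {x : E} {ξ : W}
    (hξ : ξ ∈ shapeKernel F N x) : kernelField s F N ξ x = ξ := by
  obtain ⟨hTξ, hFξ, hNξ⟩ := mem_shapeKernel.1 hξ
  simp [kernelField, focalProjection_apply_eq_zero s hTξ, hFξ, hNξ]

theorem fderiv_N_tangentPart {F N : E → W} {x : E} {ξ : W} (hξ : ξ ∈ shapeKernel F N x) :
    fderiv ℝ N x (tangentPart F N x ξ) = 0 :=
  neg_eq_zero.1 (mem_shapeKernel.1 hξ).1

/-- A local hypersurface with constant principal curvatures. The multiset `s` lists the eigenvalues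
of the ambient shape operator, so it contains two zeros besides the principal curvatures. -/
structure IsIsoparametricOn [FiniteDimensional ℝ W] (U : Set E) (F N : E → W)
    (s : Multiset ℝ) : Prop extends IsLocalHypersurface U F N where
  roots_eq : ∀ x ∈ U, (ambientShape F N x : W →ₗ[ℝ] W).charpoly.roots = s

variable [FiniteDimensional ℝ E] [FiniteDimensional ℝ W]

namespace IsIsoparametricOn

variable {U : Set E} {F N : E → W} {s : Multiset ℝ} {x : E}

theorem contDiffOn_shapePinv (h : IsIsoparametricOn U F N s) :
    ContDiffOn ℝ ∞ (shapePinv s F N) U :=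
  contDiffOn_aeval h.contDiffOn_ambientShape _

theorem contDiffOn_focalProjection (h : IsIsoparametricOn U F N s) :
    ContDiffOn ℝ ∞ (focalProjection s F N) U :=
  h.contDiffOn_ambientShape.mul h.contDiffOn_shapePinv

theorem contDiffOn_focalTensor (h : IsIsoparametricOn U F N s) :
    ContDiffOn ℝ ∞ (focalTensor s F N) U :=
  (h.contDiffOn_focalProjection.fderiv_of_isOpen h.isOpen (by simp)).clm_comp
    (h.contDiffOn_tangentPart.clm_comp h.contDiffOn_shapePinv).neg

theorem differentiableAt_shapePinv (h : IsIsoparametricOn U F N s) (hx : x ∈ U) :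
    DifferentiableAt ℝ (shapePinv s F N) x :=
  (h.contDiffOn_shapePinv.contDiffAt (h.isOpen.mem_nhds hx)).differentiableAt (by simp)

theorem differentiableAt_focalProjection (h : IsIsoparametricOn U F N s) (hx : x ∈ U) :
    DifferentiableAt ℝ (focalProjection s F N) x :=
  (h.contDiffOn_focalProjection.contDiffAt (h.isOpen.mem_nhds hx)).differentiableAt (by simp)

theorem differentiableAt_focalTensor (h : IsIsoparametricOn U F N s) (hx : x ∈ U) :
    DifferentiableAt ℝ (focalTensor s F N) x :=
  (h.contDiffOn_focalTensor.contDiffAt (h.isOpen.mem_nhds hx)).differentiableAt (by simp)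

theorem isSymmetric_shapePinv (h : IsIsoparametricOn U F N s) (hx : x ∈ U) :
    (shapePinv s F N x : W →ₗ[ℝ] W).IsSymmetric :=
  isSymmetric_pseudoInverse s (h.isSymmetric_ambientShape hx)

theorem isSymmetric_focalProjection (h : IsIsoparametricOn U F N s) (hx : x ∈ U) :
    (focalProjection s F N x : W →ₗ[ℝ] W).IsSymmetric :=
  isSymmetric_mul_pseudoInverse s (h.isSymmetric_ambientShape hx)

theorem traceCLM_shapePinv_pow (h : IsIsoparametricOn U F N s) (hx : x ∈ U) (k : ℕ) :
    traceCLM W (shapePinv s F N x ^ k) = (s.map fun μ ↦ μ⁻¹ ^ k).sum :=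
  traceCLM_pseudoInverse_pow (h.isSymmetric_ambientShape hx) (h.roots_eq x hx) k

theorem focalProjection_mul_ambientShape (h : IsIsoparametricOn U F N s) (hx : x ∈ U) :
    focalProjection s F N x * ambientShape F N x = ambientShape F N x :=
  mul_pseudoInverse_mul (h.isSymmetric_ambientShape hx) (h.roots_eq x hx)

theorem ambientShape_mul_focalProjection (h : IsIsoparametricOn U F N s) (hx : x ∈ U) :
    ambientShape F N x * focalProjection s F N x = ambientShape F N x := by
  rw [focalProjection, shapePinv, ← pseudoInverse_mul_comm, ← mul_assoc]
  exact h.focalProjection_mul_ambientShape hx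

theorem shapePinv_mul_focalProjection (h : IsIsoparametricOn U F N s) (hx : x ∈ U) :
    shapePinv s F N x * focalProjection s F N x = shapePinv s F N x := by
  rw [focalProjection, ← mul_assoc]
  exact pseudoInverse_mul_mul (h.isSymmetric_ambientShape hx) (h.roots_eq x hx)

theorem focalProjection_mul_self (h : IsIsoparametricOn U F N s) (hx : x ∈ U) :
    focalProjection s F N x * focalProjection s F N x = focalProjection s F N x := by
  nth_rw 1 [focalProjection]
  rw [mul_assoc, h.shapePinv_mul_focalProjection hx, focalProjection]

theorem focalProjection_fderiv_N (h : IsIsoparametricOn U F N s) (hx : x ∈ U) (v : E) :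
    focalProjection s F N x (fderiv ℝ N x v) = fderiv ℝ N x v := by
  have := DFunLike.congr_fun (h.focalProjection_mul_ambientShape hx) (fderiv ℝ F x v)
  simpa [h.ambientShape_fderiv_F hx] using this

theorem focalProjection_fderiv_F (h : IsIsoparametricOn U F N s) (hx : x ∈ U) (v : E) :
    focalProjection s F N x (fderiv ℝ F x v) = -shapePinv s F N x (fderiv ℝ N x v) := by
  rw [focalProjection, shapePinv, ← pseudoInverse_mul_comm, mul_apply_eq_comp,
    h.ambientShape_fderiv_F hx, map_neg]

theorem focalLift_focalProjection (h : IsIsoparametricOn U F N s) (hx : x ∈ U) (u : W) :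
    focalLift s F N x (focalProjection s F N x u) = focalLift s F N x u :=
  congrArg (fun w ↦ -tangentPart F N x w)
    (DFunLike.congr_fun (h.shapePinv_mul_focalProjection hx) u)

theorem fderiv_focalProjection_apply (h : IsIsoparametricOn U F N s) (hx : x ∈ U) {η : E → W}
    (hη : DifferentiableAt ℝ η x) (h0 : ∀ y ∈ U, ambientShape F N y (η y) = 0) (v : E) :
    fderiv ℝ (focalProjection s F N) x v (η x) = -focalProjection s F N x (fderiv ℝ η x v) := by
  have hzero : (fun y ↦ focalProjection s F N y (η y)) =ᶠ[𝓝 x] fun _ ↦ 0 :=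
    (h.eventually_mem hx).mono fun y hy ↦ focalProjection_apply_eq_zero s (h0 y hy)
  have := DFunLike.congr_fun (hzero.fderiv_eq (𝕜 := ℝ)) v
  rw [fderiv_clm_apply (h.differentiableAt_focalProjection hx) hη] at this
  exact eq_neg_of_add_eq_zero_right (by simpa using this)

theorem fderiv_focalProjection_eq_zero (h : IsIsoparametricOn U F N s) (hx : x ∈ U) {X : E}
    (hX : fderiv ℝ N x X = 0) : fderiv ℝ (focalProjection s F N) x X = 0 := by
  set D := fderiv ℝ (focalProjection s F N) x X
  set P := focalProjection s F N x
  have hDP (u : W) : D (P u) = 0 := by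
    rw [← fderiv_N_focalLift]
    exact fderiv_apply_fderiv_eq_zero_of_fderiv_eq_comp (contDiffAt_infty.1 (h.contDiffAt_N hx) 2)
      (contDiffAt_infty.1 (h.contDiffAt_N hx) 2) (h.differentiableAt_focalProjection hx)
      ((h.eventually_mem hx).mono fun y hy ↦
        ContinuousLinearMap.ext fun v ↦ (h.focalProjection_fderiv_N hy v).symm) hX _
  have hD_symm : (D : W →ₗ[ℝ] W).IsSymmetric :=
    isSymmetric_fderiv (h.differentiableAt_focalProjection hx)
      ((h.eventually_mem hx).mono fun y hy ↦ h.isSymmetric_focalProjection hy) X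
  have hPD (u : W) : P (D u) = 0 := ext_inner_right ℝ fun w ↦ by
    rw [(h.isSymmetric_focalProjection hx).apply_clm, hD_symm.apply_clm, hDP]
    simp
  have hsum : P * D + D * P = D := by
    have hP := h.differentiableAt_focalProjection hx
    rw [← fderiv_mul_apply hP hP]
    exact congr($(Filter.EventuallyEq.fderiv_eq
      ((h.eventually_mem hx).mono fun y hy ↦ h.focalProjection_mul_self hy)) X)
  ext1 u
  simpa [hDP, hPD] using DFunLike.congr_fun hsum.symm u

theorem fderiv_focalProjection (h : IsIsoparametricOn U F N s) (hx : x ∈ U) :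
    fderiv ℝ (focalProjection s F N) x = focalTensor s F N x ∘L fderiv ℝ N x := by
  ext1 v
  have hker : fderiv ℝ N x (v - focalLift s F N x (fderiv ℝ N x v)) = 0 := by
    rw [map_sub, fderiv_N_focalLift, h.focalProjection_fderiv_N hx, sub_self]
  exact sub_eq_zero.1 ((map_sub _ _ _).symm.trans (h.fderiv_focalProjection_eq_zero hx hker))

theorem focalShape_apply_focalProjection (h : IsIsoparametricOn U F N s) (hx : x ∈ U) (w u : W) :
    focalShape s F N x w (focalProjection s F N x u) = focalShape s F N x w u := by
  simp [focalShape, focalTensor, h.focalLift_focalProjection hx]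

theorem fderiv_focalTensor_eq_zero (h : IsIsoparametricOn U F N s) (hx : x ∈ U) {X : E}
    (hX : fderiv ℝ N x X = 0) : fderiv ℝ (focalTensor s F N) x X = 0 := by
  have hBP (u : W) : fderiv ℝ (focalTensor s F N) x X (focalProjection s F N x u) = 0 := by
    rw [← fderiv_N_focalLift]
    exact fderiv_apply_fderiv_eq_zero_of_fderiv_eq_comp
      (contDiffAt_infty.1 (h.contDiffOn_focalProjection.contDiffAt (h.isOpen.mem_nhds hx)) 2)
      (contDiffAt_infty.1 (h.contDiffAt_N hx) 2) (h.differentiableAt_focalTensor hx)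
      ((h.eventually_mem hx).mono fun y hy ↦ h.fderiv_focalProjection hy) hX _
  have hcomp : fderiv ℝ (fun y ↦ focalTensor s F N y ∘L focalProjection s F N y) x =
      fderiv ℝ (focalTensor s F N) x := Filter.EventuallyEq.fderiv_eq <|
    (h.eventually_mem hx).mono fun y hy ↦ ContinuousLinearMap.ext fun u ↦
      congrArg _ (h.focalLift_focalProjection hy u)
  rw [fderiv_clm_comp (h.differentiableAt_focalTensor hx)
    (h.differentiableAt_focalProjection hx)] at hcomp
  ext1 u
  have := congr($hcomp X u)
  simpa [hBP, h.fderiv_focalProjection_eq_zero hx hX] using this.symm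

theorem focalShape_F (h : IsIsoparametricOn U F N s) (hx : x ∈ U) :
    focalShape s F N x (F x) = shapePinv s F N x := by
  ext1 u
  calc focalShape s F N x (F x) u
      = fderiv ℝ (focalProjection s F N) x (focalLift s F N x u) (F x) := rfl
    _ = shapePinv s F N x (focalProjection s F N x u) := by
      rw [h.fderiv_focalProjection_apply hx (h.differentiableAt_F hx) fun y ↦ h.ambientShape_F,
        h.focalProjection_fderiv_F hx, neg_neg, fderiv_N_focalLift]
    _ = shapePinv s F N x u := DFunLike.congr_fun (h.shapePinv_mul_focalProjection hx) u

theorem focalShape_N (h : IsIsoparametricOn U F N s) (hx : x ∈ U) :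
    focalShape s F N x (N x) = -focalProjection s F N x := by
  ext1 u
  calc focalShape s F N x (N x) u
      = fderiv ℝ (focalProjection s F N) x (focalLift s F N x u) (N x) := rfl
    _ = -focalProjection s F N x u := by
      rw [h.fderiv_focalProjection_apply hx (h.differentiableAt_N hx) fun y ↦ h.ambientShape_N,
        h.focalProjection_fderiv_N hx, fderiv_N_focalLift]

theorem contDiffOn_focalShape (h : IsIsoparametricOn U F N s) :
    ContDiffOn ℝ ∞ (focalShape s F N) U :=
  contDiffOn_clm_apply.2 fun _ ↦ contDiffOn_clm_apply.2 fun _ ↦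
    (h.contDiffOn_focalTensor.clm_apply contDiffOn_const).clm_apply contDiffOn_const

theorem differentiableAt_focalShape (h : IsIsoparametricOn U F N s) (hx : x ∈ U) :
    DifferentiableAt ℝ (focalShape s F N) x :=
  (h.contDiffOn_focalShape.contDiffAt (h.isOpen.mem_nhds hx)).differentiableAt (by simp)

theorem fderiv_focalShape_eq_zero (h : IsIsoparametricOn U F N s) (hx : x ∈ U) {X : E}
    (hX : fderiv ℝ N x X = 0) : fderiv ℝ (focalShape s F N) x X = 0 := by
  ext w u
  have hG := h.differentiableAt_focalShape hx
  have hB := h.differentiableAt_focalTensor hx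
  have hw := differentiableAt_const (𝕜 := ℝ) (x := x) w
  have hu := differentiableAt_const (𝕜 := ℝ) (x := x) u
  calc fderiv ℝ (focalShape s F N) x X w u
      = fderiv ℝ (fun y ↦ focalShape s F N y w u) x X := by
        simp [fderiv_clm_apply (hG.clm_apply hw) hu, fderiv_clm_apply hG hw]
    _ = fderiv ℝ (fun y ↦ focalTensor s F N y u w) x X := rfl
    _ = fderiv ℝ (focalTensor s F N) x X u w := by
        simp [fderiv_clm_apply (hB.clm_apply hu) hw, fderiv_clm_apply hB hu]
    _ = 0 := by simp [h.fderiv_focalTensor_eq_zero hx hX]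

theorem fderiv_focalShape_apply (h : IsIsoparametricOn U F N s) (hx : x ∈ U) {X : E}
    (hX : fderiv ℝ N x X = 0) {η : E → W} (hη : DifferentiableAt ℝ η x) :
    fderiv ℝ (fun y ↦ focalShape s F N y (η y)) x X = focalShape s F N x (fderiv ℝ η x X) := by
  rw [fderiv_clm_apply (h.differentiableAt_focalShape hx) hη]
  simp [h.fderiv_focalShape_eq_zero hx hX]

theorem fderiv_shapePinv (h : IsIsoparametricOn U F N s) (hx : x ∈ U) {X : E}
    (hX : fderiv ℝ N x X = 0) :
    fderiv ℝ (shapePinv s F N) x X = focalShape s F N x (fderiv ℝ F x X) := by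
  rw [← h.fderiv_focalShape_apply hx hX (h.differentiableAt_F hx)]
  exact congr($(Filter.EventuallyEq.fderiv_eq
    ((h.eventually_mem hx).mono fun y hy ↦ (h.focalShape_F hy).symm)) X)

theorem isSymmetric_focalShape (h : IsIsoparametricOn U F N s) (hx : x ∈ U) {w : W}
    (hw : ambientShape F N x w = 0) : (focalShape s F N x w : W →ₗ[ℝ] W).IsSymmetric := by
  obtain ⟨X, a, b, rfl⟩ := h.exists_eq_fderiv_F_add hx w
  have hX : fderiv ℝ N x X = 0 := by
    simpa [h.ambientShape_fderiv_F hx, h.ambientShape_F hx, h.ambientShape_N hx] using hw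
  have hdR := isSymmetric_fderiv (h.differentiableAt_shapePinv hx)
    ((h.eventually_mem hx).mono fun y hy ↦ h.isSymmetric_shapePinv hy) X
  rw [h.fderiv_shapePinv hx hX] at hdR
  rw [map_add, map_add, map_smul, map_smul, h.focalShape_F hx, h.focalShape_N hx, smul_neg,
    ← neg_smul]
  exact hdR.add (((h.isSymmetric_shapePinv hx).smul (by simp)).add
    ((h.isSymmetric_focalProjection hx).smul (by simp)))

variable {ξ : W}

theorem kernelField_mem (h : IsIsoparametricOn U F N s) (hx : x ∈ U) (ξ : W) :
    kernelField s F N ξ x ∈ shapeKernel F N x := by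
  have hFN := h.inner_F_N x hx
  have hNF : inner ℝ (N x) (F x) = 0 := by rw [real_inner_comm, hFN]
  have hP := h.isSymmetric_focalProjection hx
  have hFP : inner ℝ (F x) (focalProjection s F N x ξ) = 0 := by
    rw [← hP.apply_clm, focalProjection_apply_eq_zero s (h.ambientShape_F hx), inner_zero_left]
  have hNP : inner ℝ (N x) (focalProjection s F N x ξ) = 0 := by
    rw [← hP.apply_clm, focalProjection_apply_eq_zero s (h.ambientShape_N hx), inner_zero_left]
  have hTP := DFunLike.congr_fun (h.ambientShape_mul_focalProjection hx) ξ
  rw [mul_apply_eq_comp] at hTP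
  simp [mem_shapeKernel, kernelField, inner_sub_right, inner_smul_right, h.ambientShape_F hx,
    h.ambientShape_N hx, h.norm_F x hx, h.norm_N x hx, hFN, hNF, hFP, hNP, hTP]

theorem differentiableAt_kernelField (h : IsIsoparametricOn U F N s) (hx : x ∈ U) (ξ : W) :
    DifferentiableAt ℝ (kernelField s F N ξ) x := by
  have hF := h.differentiableAt_F hx
  have hN := h.differentiableAt_N hx
  have hP := h.differentiableAt_focalProjection hx
  exact (((differentiableAt_const ξ).sub (hP.clm_apply (differentiableAt_const ξ))).sub
    ((hF.inner ℝ (differentiableAt_const ξ)).smul hF)).sub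
    ((hN.inner ℝ (differentiableAt_const ξ)).smul hN)

theorem fderiv_kernelField (h : IsIsoparametricOn U F N s) (hx : x ∈ U)
    (hξ : ξ ∈ shapeKernel F N x) :
    fderiv ℝ (kernelField s F N ξ) x (tangentPart F N x ξ) = -‖ξ‖ ^ 2 • F x := by
  obtain ⟨-, hFξ, hNξ⟩ := mem_shapeKernel.1 hξ
  have hdP := h.fderiv_focalProjection_eq_zero hx (fderiv_N_tangentPart hξ)
  have hF := (h.differentiableAt_F hx).hasFDerivAt
  have hN := (h.differentiableAt_N hx).hasFDerivAt
  have hP := (h.differentiableAt_focalProjection hx).hasFDerivAt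
  have key := (((hP.clm_apply (hasFDerivAt_const ξ x)).const_sub ξ).sub
    ((hF.inner ℝ (hasFDerivAt_const ξ x)).smul hF)).sub
    ((hN.inner ℝ (hasFDerivAt_const ξ x)).smul hN)
  rw [show fderiv ℝ (kernelField s F N ξ) x = _ from key.fderiv]
  simp [hdP, hFξ, hNξ, fderiv_N_tangentPart hξ, h.fderiv_F_tangentPart hx hFξ hNξ]

theorem fderiv_shapePinv_tangentPart (h : IsIsoparametricOn U F N s) (hx : x ∈ U)
    (hξ : ξ ∈ shapeKernel F N x) :
    fderiv ℝ (shapePinv s F N) x (tangentPart F N x ξ) = focalShape s F N x ξ := by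
  obtain ⟨-, hFξ, hNξ⟩ := mem_shapeKernel.1 hξ
  rw [h.fderiv_shapePinv hx (fderiv_N_tangentPart hξ), h.fderiv_F_tangentPart hx hFξ hNξ]

theorem differentiableAt_focalShape_kernelField (h : IsIsoparametricOn U F N s) (hx : x ∈ U)
    (ξ : W) : DifferentiableAt ℝ (fun y ↦ focalShape s F N y (kernelField s F N ξ y)) x :=
  (h.differentiableAt_focalShape hx).clm_apply (h.differentiableAt_kernelField hx ξ)

theorem fderiv_focalShape_kernelField (h : IsIsoparametricOn U F N s) (hx : x ∈ U)
    (hξ : ξ ∈ shapeKernel F N x) :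
    fderiv ℝ (fun y ↦ focalShape s F N y (kernelField s F N ξ y)) x (tangentPart F N x ξ) =
      -‖ξ‖ ^ 2 • shapePinv s F N x := by
  rw [h.fderiv_focalShape_apply hx (fderiv_N_tangentPart hξ)
    (h.differentiableAt_kernelField hx ξ), h.fderiv_kernelField hx hξ, map_smul, h.focalShape_F hx]

theorem traceCLM_focalShape (h : IsIsoparametricOn U F N s) (hx : x ∈ U)
    (hξ : ξ ∈ shapeKernel F N x) : traceCLM W (focalShape s F N x ξ) = 0 := by
  rw [← h.fderiv_shapePinv_tangentPart hx hξ]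
  refine clm_apply_fderiv_eq_zero _ (c := (s.map fun μ ↦ μ⁻¹ ^ 1).sum)
    (h.differentiableAt_shapePinv hx) ((h.eventually_mem hx).mono fun y hy ↦ ?_) _
  simpa only [pow_one] using h.traceCLM_shapePinv_pow hy 1

theorem traceCLM_shapePinv_mul_focalShape (h : IsIsoparametricOn U F N s) (hx : x ∈ U)
    (hξ : ξ ∈ shapeKernel F N x) :
    traceCLM W (shapePinv s F N x * focalShape s F N x ξ) = 0 := by
  have hR := h.differentiableAt_shapePinv hx
  have htr := clm_apply_fderiv_eq_zero (traceCLM W) (hR.fun_mul hR)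
    ((h.eventually_mem hx).mono fun y hy ↦ by
      simpa only [pow_two] using h.traceCLM_shapePinv_pow hy 2) (tangentPart F N x ξ)
  rw [fderiv_mul_apply hR hR, h.fderiv_shapePinv_tangentPart hx hξ, map_add,
    traceCLM_mul_comm (focalShape s F N x ξ)] at htr
  linarith

theorem traceCLM_focalShape_mul_self (h : IsIsoparametricOn U F N s) (hx : x ∈ U)
    (hξ : ξ ∈ shapeKernel F N x) :
    traceCLM W (focalShape s F N x ξ * focalShape s F N x ξ) =
      ‖ξ‖ ^ 2 * traceCLM W (shapePinv s F N x * shapePinv s F N x) := by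
  have hR := h.differentiableAt_shapePinv hx
  have hG := h.differentiableAt_focalShape_kernelField hx ξ
  have htr := clm_apply_fderiv_eq_zero (traceCLM W) (hR.fun_mul hG)
    ((h.eventually_mem hx).mono fun y hy ↦
      h.traceCLM_shapePinv_mul_focalShape hy (h.kernelField_mem hy ξ)) (tangentPart F N x ξ)
  rw [fderiv_mul_apply hR hG, h.fderiv_shapePinv_tangentPart hx hξ,
    h.fderiv_focalShape_kernelField hx hξ, kernelField_eq s hξ, mul_smul_comm, map_add, map_smul,
    smul_eq_mul] at htr
  linarith

theorem finrank_ker_ambientShape (h : IsIsoparametricOn U F N s) (hx : x ∈ U) :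
    finrank ℝ (ambientShape F N x).ker = s.count 0 := by
  rw [← h.roots_eq x hx]
  exact finrank_ker_eq_count_roots (h.isSymmetric_ambientShape hx)

theorem traceCLM_shapePinv_eq_zero (h : IsIsoparametricOn U F N s) (hx : x ∈ U)
    (hs : 3 ≤ s.count 0) : traceCLM W (shapePinv s F N x) = 0 := by
  obtain ⟨ξ, hξ, hξ0⟩ :=
    exists_ne_zero_mem_shapeKernel (hs.trans_eq (h.finrank_ker_ambientShape hx).symm)
  have htr := clm_apply_fderiv_eq_zero (traceCLM W)
    (h.differentiableAt_focalShape_kernelField hx ξ)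
    ((h.eventually_mem hx).mono fun y hy ↦
      h.traceCLM_focalShape hy (h.kernelField_mem hy ξ)) (tangentPart F N x ξ)
  rw [h.fderiv_focalShape_kernelField hx hξ, map_smul, smul_eq_mul] at htr
  exact (mul_eq_zero.1 htr).resolve_left (by simpa using hξ0)

theorem traceCLM_focalProjection_ne_zero (h : IsIsoparametricOn U F N s) (hx : x ∈ U)
    (hT : ambientShape F N x ≠ 0) : traceCLM W (focalProjection s F N x) ≠ 0 := by
  intro h0
  rw [← h.focalProjection_mul_self hx] at h0
  have hP := eq_zero_of_traceCLM_mul_self (h.isSymmetric_focalProjection hx) h0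
  exact hT (by rw [← h.focalProjection_mul_ambientShape hx, hP, zero_mul])

theorem traceCLM_shapePinv_mul_self_ne_zero (h : IsIsoparametricOn U F N s) (hx : x ∈ U)
    (hT : ambientShape F N x ≠ 0) :
    traceCLM W (shapePinv s F N x * shapePinv s F N x) ≠ 0 := by
  intro h0
  have hR := eq_zero_of_traceCLM_mul_self (h.isSymmetric_shapePinv hx) h0
  exact h.traceCLM_focalProjection_ne_zero hx hT
    (by rw [focalProjection, hR, mul_zero, map_zero])

theorem eq_zero_of_focalShape_eq_zero (h : IsIsoparametricOn U F N s) (hx : x ∈ U)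
    (hs : 3 ≤ s.count 0) (hT : ambientShape F N x ≠ 0) {w : W} (hw : ambientShape F N x w = 0)
    (hGw : focalShape s F N x w = 0) : w = 0 := by
  obtain ⟨X, a, b, rfl⟩ := h.exists_eq_fderiv_F_add hx w
  set ξ := fderiv ℝ F x X
  have hξ : ξ ∈ shapeKernel F N x := by
    refine mem_shapeKernel.2 ⟨?_, h.inner_F_fderiv_F hx X, h.inner_N_fderiv_F x hx X⟩
    simpa [h.ambientShape_F hx, h.ambientShape_N hx] using hw
  set R := shapePinv s F N x with hR_def
  set P := focalProjection s F N x
  set G := focalShape s F N x ξ with hG_def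
  have hG : G + (a • R + b • (-P)) = 0 := by
    simpa only [map_add, map_smul, h.focalShape_F hx, h.focalShape_N hx] using hGw
  have hRR : traceCLM W (R * R) ≠ 0 := h.traceCLM_shapePinv_mul_self_ne_zero hx hT
  have ha : a = 0 := by
    have := congr(traceCLM W (R * $hG))
    simpa [mul_add, mul_smul_comm, hRR,
      show R * P = R from h.shapePinv_mul_focalProjection hx,
      show traceCLM W R = 0 from h.traceCLM_shapePinv_eq_zero hx hs,
      show traceCLM W (R * G) = 0 from h.traceCLM_shapePinv_mul_focalShape hx hξ] using this
  have hb : b = 0 := by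
    have := congr(traceCLM W $hG)
    simpa [ha, show traceCLM W G = 0 from h.traceCLM_focalShape hx hξ,
      show traceCLM W P ≠ 0 from h.traceCLM_focalProjection_ne_zero hx hT] using this
  have hξ0 : ξ = 0 := by
    have := h.traceCLM_focalShape_mul_self hx hξ
    rw [← hG_def, ← hR_def, show G = 0 by simpa [ha, hb] using hG] at this
    simpa only [mul_zero, map_zero, zero_eq_mul, hRR, or_false, sq_eq_zero_iff, norm_eq_zero]
      using this
  simp [ha, hb, hξ0]

theorem count_zero_le_choose (h : IsIsoparametricOn U F N s) (hx : x ∈ U) (hs : 3 ≤ s.count 0)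
    (hT : ambientShape F N x ≠ 0) :
    s.count 0 ≤ (finrank ℝ W - s.count 0 + 1).choose 2 := by
  set K := (ambientShape F N x).ker with hK
  have hmem (w : K) : focalShape s F N x w ∈ symmetricVanishingOn K := by
    refine ⟨h.isSymmetric_focalShape hx w.2, fun u hu ↦ ?_⟩
    rw [← h.focalShape_apply_focalProjection hx, focalProjection_apply_eq_zero s hu, map_zero]
  let Φ : K →ₗ[ℝ] symmetricVanishingOn K :=
    LinearMap.codRestrict _ ((focalShape s F N x).toLinearMap.domRestrict K) hmem
  have hΦ : Function.Injective Φ := (injective_iff_map_eq_zero Φ).2 fun w hw ↦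
    Subtype.ext (h.eq_zero_of_focalShape_eq_zero hx hs hT w.2 congr(($hw).1))
  have hKperp : finrank ℝ Kᗮ = finrank ℝ W - s.count 0 := by
    rw [← h.finrank_ker_ambientShape hx, ← hK, ← K.finrank_add_finrank_orthogonal,
      Nat.add_sub_cancel_left]
  rw [← hKperp, ← h.finrank_ker_ambientShape hx]
  exact (LinearMap.finrank_le_finrank_of_injective hΦ).trans (finrank_symmetricVanishingOn_le K)

theorem ambientShape_eq_zero (h : IsIsoparametricOn U F N s) (hx : x ∈ U) (hW : finrank ℝ W = 6)
    (hs : 3 ≤ s.count 0) (hsum : s.sum = 0) : ambientShape F N x = 0 := by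
  by_contra hT
  have hcard : s.card = 6 := by
    rw [← h.roots_eq x hx, splits_iff_card_roots.1
      (h.isSymmetric_ambientShape hx).splits_charpoly, LinearMap.charpoly_natDegree, hW]
  have hcount : s.count 0 = 3 := by
    have hle := h.count_zero_le_choose hx hs hT
    have hle6 : s.count 0 ≤ 6 := hcard ▸ s.count_le_card 0
    rw [hW] at hle
    interval_cases s.count 0 <;> simp_all [Nat.choose]
  obtain ⟨t, rfl⟩ := Multiset.le_iff_exists_add.1 (Multiset.le_count_iff_replicate_le.1 hs)
  obtain ⟨a, b, d, rfl⟩ := Multiset.card_eq_three.1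
    (show t.card = 3 by rw [Multiset.card_add, Multiset.card_replicate] at hcard; omega)
  have h0 : (0 : ℝ) ∉ ({a, b, d} : Multiset ℝ) := by
    rw [← Multiset.count_eq_zero]
    rwa [Multiset.count_add, Multiset.count_replicate_self, Nat.add_eq_left] at hcount
  obtain ⟨ha, hb, hd⟩ : a ≠ 0 ∧ b ≠ 0 ∧ d ≠ 0 := by simpa [eq_comm] using h0
  refine inv_add_inv_add_inv_ne_zero ha hb hd (by simpa [add_assoc] using hsum) ?_
  have := h.traceCLM_shapePinv_pow hx 1
  rw [pow_one, h.traceCLM_shapePinv_eq_zero hx hs] at this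
  simpa [add_assoc] using this.symm

end IsIsoparametricOn

end FocalMap

section Chart

variable {n : ℕ} {M : Type*} [TopologicalSpace M] [ChartedSpace (EuclideanSpace ℝ (Fin n)) M]

/-- A map on the manifold, read in the chart at `p`. -/
def chartRep {V : Type*} (p : M) (g : M → V) (x : EuclideanSpace ℝ (Fin n)) : V :=
  g ((extChartAt (𝓡 n) p).symm x)

/-- A subset of the manifold, read in the chart at `p`. -/
def chartDomain (p : M) (U : Set M) : Set (EuclideanSpace ℝ (Fin n)) :=
  (extChartAt (𝓡 n) p).target ∩ (extChartAt (𝓡 n) p).symm ⁻¹' U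

theorem mem_chartDomain {p : M} {U : Set M} (hp : p ∈ U) :
    extChartAt (𝓡 n) p p ∈ chartDomain p U :=
  ⟨mem_extChartAt_target p, by simpa using hp⟩

variable {f : M → UnitSphere n} {ν : M → Ambient n} {U : Set M}

theorem IsUnitNormalOn.mdifferentiableAt (hν : IsUnitNormalOn f ν U) {p : M} (hp : p ∈ U) :
    MDifferentiableAt (𝓡 n) 𝓘(ℝ, Ambient n) ν p :=
  (hν.contMDiffOn.contMDiffAt (hν.isOpen.mem_nhds hp)).mdifferentiableAt (by simp)

theorem IsHypersurface.contMDiff_coe (hf : IsHypersurface f) :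
    ContMDiff (𝓡 n) 𝓘(ℝ, Ambient n) ∞ (fun q ↦ (f q : Ambient n)) := by
  have : Fact (finrank ℝ (Ambient n) = n + 1 + 1) := ⟨finrank_euclideanSpace_fin⟩
  exact contMDiff_coe_sphere.comp hf.contMDiff

theorem IsHypersurface.mdifferentiableAt_coe (hf : IsHypersurface f) (p : M) :
    MDifferentiableAt (𝓡 n) 𝓘(ℝ, Ambient n) (fun q ↦ (f q : Ambient n)) p :=
  hf.contMDiff_coe.mdifferentiableAt (by simp)

variable [IsManifold (𝓡 n) ∞ M]

theorem exists_fderiv_chartRep (p : M) {x : EuclideanSpace ℝ (Fin n)}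
    (hx : x ∈ (extChartAt (𝓡 n) p).target) :
    ∃ A : EuclideanSpace ℝ (Fin n) ≃L[ℝ] TangentSpace (𝓡 n) ((extChartAt (𝓡 n) p).symm x),
      ∀ g : M → Ambient n,
        MDifferentiableAt (𝓡 n) 𝓘(ℝ, Ambient n) g ((extChartAt (𝓡 n) p).symm x) →
        ∀ v, fderiv ℝ (chartRep (n := n) p g) x v =
          mvfderiv (𝓡 n) g ((extChartAt (𝓡 n) p).symm x) (A v) := by
  have : IsManifold (𝓡 n) 1 M := .of_le (n := ∞) (WithTop.coe_le_coe.2 le_top)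
  have hsymm : MDifferentiableAt 𝓘(ℝ, EuclideanSpace ℝ (Fin n)) (𝓡 n)
      (extChartAt (𝓡 n) p).symm x := by
    simpa only [ModelWithCorners.range_eq_univ, mdifferentiableWithinAt_univ] using
      mdifferentiableWithinAt_extChartAt_symm (I := 𝓡 n) hx
  obtain ⟨A, hA⟩ := isInvertible_mfderivWithin_extChartAt_symm (I := 𝓡 n) (x := p) hx
  rw [ModelWithCorners.range_eq_univ, mfderivWithin_univ] at hA
  refine ⟨A, fun g hg v ↦ ?_⟩
  have hcomp := mfderiv_comp_apply x hg hsymm v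
  rw [← hA] at hcomp
  rw [← mfderiv_eq_fderiv]
  exact hcomp

theorem IsHypersurface.isLocalHypersurface (hf : IsHypersurface f) (hν : IsUnitNormalOn f ν U)
    (p : M) :
    IsLocalHypersurface (chartDomain (n := n) p U) (chartRep (n := n) p fun q ↦ (f q : Ambient n))
      (chartRep (n := n) p ν) where
  isOpen := (continuousOn_extChartAt_symm p).isOpen_inter_preimage
    (isOpen_extChartAt_target p) hν.isOpen
  finrank_eq := by simp
  contDiffOn_F := contMDiffOn_iff_contDiffOn.1 <|
    hf.contMDiff_coe.comp_contMDiffOn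
      ((contMDiffOn_extChartAt_symm p).mono Set.inter_subset_left)
  contDiffOn_N := contMDiffOn_iff_contDiffOn.1 <|
    hν.contMDiffOn.comp ((contMDiffOn_extChartAt_symm p).mono Set.inter_subset_left)
      fun _ hx ↦ hx.2
  norm_F := fun x _ ↦ by simp [chartRep]
  norm_N := fun x hx ↦ hν.norm_eq_one _ hx.2
  inner_F_N := fun x hx ↦ (real_inner_comm _ _).trans (hν.tangent_sphere _ hx.2)
  inner_N_fderiv_F := fun x hx v ↦ by
    obtain ⟨A, hA⟩ := exists_fderiv_chartRep p hx.1
    rw [hA _ (hf.mdifferentiableAt_coe _)]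
    exact hν.normal _ hx.2 _
  injective_fderiv_F := fun x hx v w h ↦ by
    obtain ⟨A, hA⟩ := exists_fderiv_chartRep p hx.1
    rw [hA _ (hf.mdifferentiableAt_coe _), hA _ (hf.mdifferentiableAt_coe _)] at h
    exact A.injective (hf.injective_differential _ h)

theorem IsHypersurface.charpoly_ambientShape (hf : IsHypersurface f) (hν : IsUnitNormalOn f ν U)
    (p : M) {x : EuclideanSpace ℝ (Fin n)} (hx : x ∈ chartDomain p U) :
    (ambientShape (chartRep (n := n) p fun q ↦ (f q : Ambient n)) (chartRep (n := n) p ν) x :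
      Ambient n →ₗ[ℝ] Ambient n).charpoly =
      (shapeOperator f ν ((extChartAt (𝓡 n) p).symm x)).charpoly * X ^ 2 := by
  have h := hf.isLocalHypersurface hν p
  obtain ⟨A, hA⟩ := exists_fderiv_chartRep p hx.1
  let S : EuclideanSpace ℝ (Fin n) →ₗ[ℝ] EuclideanSpace ℝ (Fin n) :=
    A.symm.toLinearEquiv.conj (shapeOperator f ν ((extChartAt (𝓡 n) p).symm x))
  have hS (v : EuclideanSpace ℝ (Fin n)) :
      A (S v) = shapeOperator f ν ((extChartAt (𝓡 n) p).symm x) (A v) :=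
    A.apply_symm_apply _
  rw [h.charpoly_ambientShape hx (S := S), LinearEquiv.charpoly_conj]
  intro v
  rw [hA _ (hf.mdifferentiableAt_coe _), hA _ (hν.mdifferentiableAt hx.2), hS]
  exact differential_shapeOperator hf hν hx.2 (A v)

theorem IsHypersurface.roots_ambientShape (hf : IsHypersurface f) (hν : IsUnitNormalOn f ν U)
    (p : M) {x : EuclideanSpace ℝ (Fin n)} (hx : x ∈ chartDomain p U) :
    (ambientShape (chartRep (n := n) p fun q ↦ (f q : Ambient n)) (chartRep (n := n) p ν) x :
      Ambient n →ₗ[ℝ] Ambient n).charpoly.roots =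
      0 ::ₘ 0 ::ₘ principalCurvatures f ν ((extChartAt (𝓡 n) p).symm x) := by
  rw [hf.charpoly_ambientShape hν p hx, roots_mul
    (mul_ne_zero (LinearMap.charpoly_monic _).ne_zero (by simp)), roots_X_pow, add_comm, two_nsmul,
    add_assoc]
  rfl

theorem IsHypersurface.isIsoparametricOn (hf : IsHypersurface f) (hν : IsUnitNormalOn f ν U)
    {c : Multiset ℝ} (hc : ∀ q ∈ U, principalCurvatures f ν q = c) (p : M) :
    IsIsoparametricOn (chartDomain (n := n) p U) (chartRep (n := n) p fun q ↦ (f q : Ambient n))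
      (chartRep (n := n) p ν) (0 ::ₘ 0 ::ₘ c) where
  __ := hf.isLocalHypersurface hν p
  roots_eq := fun x hx ↦ by rw [hf.roots_ambientShape hν p hx, hc _ hx.2]

theorem IsHypersurface.splits_charpoly (hf : IsHypersurface f) (hν : IsUnitNormalOn f ν U)
    {p : M} (hp : p ∈ U) : (shapeOperator f ν p).charpoly.Splits := by
  have hsplits :=
    ((hf.isLocalHypersurface hν p).isSymmetric_ambientShape (mem_chartDomain hp)).splits_charpoly
  rw [hf.charpoly_ambientShape hν p (mem_chartDomain hp), extChartAt_to_inv] at hsplits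
  exact hsplits.of_dvd (mul_ne_zero (LinearMap.charpoly_monic _).ne_zero (by simp))
    (dvd_mul_right _ _)

theorem IsHypersurface.meanCurvature_eq (hf : IsHypersurface f) (hν : IsUnitNormalOn f ν U)
    {p : M} (hp : p ∈ U) :
    meanCurvature f ν p = (n : ℝ)⁻¹ * (principalCurvatures f ν p).sum := by
  rw [principalCurvatures,
    ← Module.End.trace_eq_sum_roots_charpoly_of_splits (hf.splits_charpoly hν hp), meanCurvature]

theorem IsHypersurface.prod_principalCurvatures (hf : IsHypersurface f)
    (hν : IsUnitNormalOn f ν U) {p : M} (hp : p ∈ U) :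
    (principalCurvatures f ν p).prod = gaussCurvature f ν p :=
  (Module.End.det_eq_prod_roots_charpoly_of_splits (hf.splits_charpoly hν hp)).symm

theorem IsHypersurface.secondFundamentalForm_eq_zero (hf : IsHypersurface f)
    (hν : IsUnitNormalOn f ν U) {ν' : M → Ambient n} {U' : Set M} (hν' : IsUnitNormalOn f ν' U')
    {p : M} (hp : p ∈ U) (hp' : p ∈ U')
    (h0 : ambientShape (chartRep (n := n) p fun q ↦ (f q : Ambient n)) (chartRep (n := n) p ν')
      (extChartAt (𝓡 n) p p) = 0) (v w : TangentSpace (𝓡 n) p) :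
    secondFundamentalForm f ν p v w = 0 := by
  have hframe := exists_fderiv_chartRep p (mem_extChartAt_target (I := 𝓡 n) p)
  rw [extChartAt_to_inv] at hframe
  obtain ⟨A, hA⟩ := hframe
  obtain ⟨v, rfl⟩ := A.surjective v
  obtain ⟨w, rfl⟩ := A.surjective w
  have := (hf.isLocalHypersurface hν p).inner_fderiv_N_fderiv_F_eq_zero
    (hf.isLocalHypersurface hν' p) (mem_chartDomain hp) (mem_chartDomain hp') h0 v w
  rw [hA _ (hf.mdifferentiableAt_coe _), hA _ (hν.mdifferentiableAt hp)] at this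
  exact neg_eq_zero.2 this

end Chart

end SphereHypersurface

end

theorem lemma3p2 {M : Type*} [TopologicalSpace M] [ChartedSpace (EuclideanSpace ℝ (Fin 4)) M]
    [IsManifold (𝓡 4) ∞ M] (f : M → Metric.sphere (0 : EuclideanSpace ℝ (Fin 6)) 1)
    (hf : SphereHypersurface.IsHypersurface f)
    (hmin : SphereHypersurface.IsMinimal f)
    (hiso : SphereHypersurface.IsIsoparametric f)
    (hgauss : SphereHypersurface.HasZeroGaussCurvature f) :
    SphereHypersurface.IsTotallyGeodesic f := by
  intro U ν hν p hp
  obtain ⟨c, hc⟩ := hiso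
  obtain ⟨U', ν', hp', hν', hcU'⟩ := hc p
  have hsum : c.sum = 0 := by
    simpa [hf.meanCurvature_eq hν' hp', hcU' p hp'] using hmin U' ν' hν' p hp'
  have h0 : 0 ∈ c := by
    rw [← Multiset.prod_eq_zero_iff, ← hcU' p hp', hf.prod_principalCurvatures hν' hp',
      hgauss U' ν' hν' p hp']
  have hcount : 3 ≤ (0 ::ₘ 0 ::ₘ c).count 0 := by
    simpa [Nat.one_le_iff_ne_zero] using h0
  have hshape := (hf.isIsoparametricOn hν' hcU' p).ambientShape_eq_zero
    (SphereHypersurface.mem_chartDomain hp') finrank_euclideanSpace_fin hcount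
    (by simpa using hsum)
  exact hf.secondFundamentalForm_eq_zero hν hν' hp hp' hshape
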